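/- For an open set $\Omega\subseteq\mathbb R^d$ let $H^1(\Omega)$ be the Sobolev space of complex-valued $f\in L^2(\Omega)$ whose weak gradient $\nabla f$ exists and lies in $L^2(\Omega;\mathbb C^d)$, with the norm $\|f\|_1^2=\|\nabla f\|_{L^2(\Omega;\mathbb C^d)}^2+\|f\|_{L^2(\Omega)}^2$. An extension operator for $\Omega$ is a linear operator $E\colon H^1(\Omega)\to H^1(\mathbb R^d)$ such that $(Ef)|_\Omega=f$ for all $f\in H^1(\Omega)$ and $\|E\|_1:=\sup_{\|f\|_1=1}\|Ef\|_1<\infty$. Put \[ \mathcal E(\Omega):=\inf_E\|E\|_1\in[0,\infty], \] the infimum being taken over all extension operators $E$ for $\Omega$ (with $\inf\emptyset=+\infty$). For $\varphi\in(0,\pi)$ let \[ \Omega_\varphi:=\{(x_1,x_2)\in\mathbb R^2 : x_2>\cot(\varphi/2)\,|x_1|\}. \] **Proposition.** For every $\varphi\in(0,\pi)$, \[ \mathcal E(\Omega_\varphi)\ \ge\ \sqrt{1+\frac{1}{\sin(\varphi/2)}} . \] In particular, $\lim_{\varphi\to0+}\mathcal E(\Omega_\varphi)=+\infty$. -/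

import Mathlib

open MeasureTheory Set Filter Topology
open scoped ENNReal ContDiff

noncomputable section

/-- The space `L²(Ω)` of complex-valued functions on `Ω ⊆ ℝ^d` (Lebesgue measure). -/
abbrev L2 {d : ℕ} (Ω : Set (EuclideanSpace ℝ (Fin d))) :=
  Lp (α := EuclideanSpace ℝ (Fin d)) ℂ 2 (volume.restrict Ω)

/-- `g` is the weak `i`-th partial derivative of `f` on `Ω`:
`∫_Ω f ∂ᵢψ = - ∫_Ω g ψ` for all test functions `ψ ∈ C_c^∞(Ω)`. -/
def IsWeakPartial {d : ℕ} (Ω : Set (EuclideanSpace ℝ (Fin d))) (i : Fin d)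
    (f g : EuclideanSpace ℝ (Fin d) → ℂ) : Prop :=
  ∀ ψ : EuclideanSpace ℝ (Fin d) → ℝ, ContDiff ℝ ∞ ψ → HasCompactSupport ψ → tsupport ψ ⊆ Ω →
    ∫ x in Ω, (fderiv ℝ ψ x (EuclideanSpace.single i 1)) • f x = - ∫ x in Ω, ψ x • g x

/-- An `L²(Ω)` function is integrable against a continuous compactly supported function. -/
theorem integrable_smul_L2 {d : ℕ} {Ω : Set (EuclideanSpace ℝ (Fin d))} (f : L2 Ω)
    {ψ : EuclideanSpace ℝ (Fin d) → ℝ} (hψ : Continuous ψ) (hc : HasCompactSupport ψ) :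
    Integrable (fun x => ψ x • f x) (volume.restrict Ω) := by
  have hf : LocallyIntegrable f (volume.restrict Ω) :=
    (Lp.memLp f).locallyIntegrable (by norm_num)
  exact hf.integrable_smul_left_of_hasCompactSupport hψ hc

theorem continuous_partial {d : ℕ} {ψ : EuclideanSpace ℝ (Fin d) → ℝ} (hψ : ContDiff ℝ ∞ ψ)
    (v : EuclideanSpace ℝ (Fin d)) : Continuous (fun x => fderiv ℝ ψ x v) :=
  (hψ.continuous_fderiv (by simp)).clm_apply continuous_const

theorem IsWeakPartial.add {d : ℕ} {Ω : Set (EuclideanSpace ℝ (Fin d))} {i : Fin d}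
    {f f' g g' : L2 Ω} (h : IsWeakPartial Ω i f g) (h' : IsWeakPartial Ω i f' g') :
    IsWeakPartial Ω i (f + f' : L2 Ω) (g + g' : L2 Ω) := by
  intro ψ hψ hc hs
  have hd := continuous_partial hψ (EuclideanSpace.single i 1)
  have hcd : HasCompactSupport (fun x => fderiv ℝ ψ x (EuclideanSpace.single i 1)) :=
    hc.fderiv_apply (𝕜 := ℝ) _
  have e1 : ∫ x in Ω, (fderiv ℝ ψ x (EuclideanSpace.single i 1)) • (f + f' : L2 Ω) x =
      ∫ x in Ω, ((fderiv ℝ ψ x (EuclideanSpace.single i 1)) • f x +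
        (fderiv ℝ ψ x (EuclideanSpace.single i 1)) • f' x) := by
    refine integral_congr_ae ?_
    filter_upwards [Lp.coeFn_add f f'] with x hx
    rw [hx, Pi.add_apply, smul_add]
  have e2 : ∫ x in Ω, ψ x • (g + g' : L2 Ω) x = ∫ x in Ω, (ψ x • g x + ψ x • g' x) := by
    refine integral_congr_ae ?_
    filter_upwards [Lp.coeFn_add g g'] with x hx
    rw [hx, Pi.add_apply, smul_add]
  rw [e1, e2, integral_add (integrable_smul_L2 f hd hcd) (integrable_smul_L2 f' hd hcd),
    integral_add (integrable_smul_L2 g hψ.continuous hc) (integrable_smul_L2 g' hψ.continuous hc),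
    h ψ hψ hc hs, h' ψ hψ hc hs]
  ring

theorem IsWeakPartial.smul {d : ℕ} {Ω : Set (EuclideanSpace ℝ (Fin d))} {i : Fin d}
    {f g : L2 Ω} (c : ℂ) (h : IsWeakPartial Ω i f g) :
    IsWeakPartial Ω i (c • f : L2 Ω) (c • g : L2 Ω) := by
  intro ψ hψ hc hs
  have e1 : ∫ x in Ω, (fderiv ℝ ψ x (EuclideanSpace.single i 1)) • (c • f : L2 Ω) x =
      ∫ x in Ω, c • ((fderiv ℝ ψ x (EuclideanSpace.single i 1)) • f x) := by
    refine integral_congr_ae ?_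
    filter_upwards [Lp.coeFn_smul c f] with x hx
    rw [hx, Pi.smul_apply, smul_comm]
  have e2 : ∫ x in Ω, ψ x • (c • g : L2 Ω) x = ∫ x in Ω, c • (ψ x • g x) := by
    refine integral_congr_ae ?_
    filter_upwards [Lp.coeFn_smul c g] with x hx
    rw [hx, Pi.smul_apply, smul_comm]
  rw [e1, e2, integral_smul, integral_smul, h ψ hψ hc hs, smul_neg]

theorem IsWeakPartial.zero {d : ℕ} (Ω : Set (EuclideanSpace ℝ (Fin d))) (i : Fin d) :
    IsWeakPartial Ω i (0 : L2 Ω) (0 : L2 Ω) := by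
  intro ψ _ _ _
  have h0 := Lp.coeFn_zero ℂ 2 (volume.restrict Ω)
  rw [integral_eq_zero_of_ae, integral_eq_zero_of_ae, neg_zero] <;>
  · filter_upwards [h0] with x hx
    have hx' : ((0 : L2 Ω) : EuclideanSpace ℝ (Fin d) → ℂ) x = 0 := hx
    simp only [Pi.zero_apply]
    rw [hx', smul_zero]

/-- On an open set the weak partial derivative is unique. -/
theorem IsWeakPartial.unique {d : ℕ} {Ω : Set (EuclideanSpace ℝ (Fin d))} (hΩ : IsOpen Ω)
    {i : Fin d} {f : EuclideanSpace ℝ (Fin d) → ℂ} {g g' : L2 Ω} (h : IsWeakPartial Ω i f g)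
    (h' : IsWeakPartial Ω i f g') : g = g' := by
  have hl : ∀ k : L2 Ω, LocallyIntegrableOn k Ω volume := fun k =>
    locallyIntegrableOn_of_locallyIntegrable_restrict
      ((Lp.memLp k).locallyIntegrable (by norm_num))
  have key := hΩ.ae_eq_zero_of_integral_contDiff_smul_eq_zero (μ := volume)
    ((hl g).sub (hl g')) (by
      intro ψ hψ hc hs
      have hz : ∀ x, x ∉ Ω → ψ x • ((g : EuclideanSpace ℝ (Fin d) → ℂ) - g') x = 0 := by
        intro x hx
        rw [image_eq_zero_of_notMem_tsupport (fun hm => hx (hs hm)), zero_smul]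
      rw [← setIntegral_eq_integral_of_forall_compl_eq_zero hz]
      simp only [Pi.sub_apply, smul_sub]
      rw [integral_sub (integrable_smul_L2 g hψ.continuous hc)
        (integrable_smul_L2 g' hψ.continuous hc), sub_eq_zero]
      exact neg_injective ((h ψ hψ hc hs).symm.trans (h' ψ hψ hc hs)))
  apply Lp.ext
  filter_upwards [(ae_restrict_iff' hΩ.measurableSet).2 key] with x hx
  simpa [sub_eq_zero] using hx

/-- The Sobolev space `H¹(Ω)` of complex-valued functions: all `f ∈ L²(Ω)` whose weak first-order
partial derivatives exist in `L²(Ω)`. -/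
def H1 {d : ℕ} (Ω : Set (EuclideanSpace ℝ (Fin d))) : Submodule ℂ (L2 Ω) where
  carrier := {f | ∀ i : Fin d, ∃ g : L2 Ω, IsWeakPartial Ω i f g}
  add_mem' := fun {a b} ha hb i => by
    obtain ⟨g, hg⟩ := ha i
    obtain ⟨g', hg'⟩ := hb i
    exact ⟨g + g', hg.add hg'⟩
  zero_mem' := fun i => ⟨0, IsWeakPartial.zero Ω i⟩
  smul_mem' := fun c f hf i => by
    obtain ⟨g, hg⟩ := hf i
    exact ⟨c • g, hg.smul c⟩

/-- The weak partial derivative `∂ᵢ f ∈ L²(Ω)` of `f ∈ H¹(Ω)` (unique for open `Ω`, by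
`IsWeakPartial.unique`). -/
def weakPartial {d : ℕ} {Ω : Set (EuclideanSpace ℝ (Fin d))} (i : Fin d) (f : H1 Ω) : L2 Ω :=
  Classical.choose (f.2 i)

theorem weakPartial_spec {d : ℕ} {Ω : Set (EuclideanSpace ℝ (Fin d))} (i : Fin d) (f : H1 Ω) :
    IsWeakPartial Ω i (f : L2 Ω) (weakPartial i f) :=
  Classical.choose_spec (f.2 i)

/-- The norm `‖f‖₁ = (‖∇f‖²_{L²(Ω;ℂ^d)} + ‖f‖²_{L²(Ω)})^{1/2}` of `H¹(Ω)`. -/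
def h1Norm {d : ℕ} {Ω : Set (EuclideanSpace ℝ (Fin d))} (f : H1 Ω) : ℝ :=
  Real.sqrt ((∑ i : Fin d, ‖weakPartial i f‖ ^ 2) + ‖(f : L2 Ω)‖ ^ 2)

/-- `‖E‖₁ = sup {‖E f‖₁ : ‖f‖₁ = 1}`, with values in `[0, ∞]`. -/
def h1OpNorm {d : ℕ} {Ω : Set (EuclideanSpace ℝ (Fin d))}
    (E : H1 Ω →ₗ[ℂ] H1 (univ : Set (EuclideanSpace ℝ (Fin d)))) : ℝ≥0∞ :=
  ⨆ (f : H1 Ω) (_ : h1Norm f = 1), ENNReal.ofReal (h1Norm (E f))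

/-- `E : H¹(Ω) → H¹(ℝ^d)` is an extension operator: `(E f)|_Ω = f` for all `f`, and
`‖E‖₁ < ∞`. -/
def IsExtensionOperator {d : ℕ} {Ω : Set (EuclideanSpace ℝ (Fin d))}
    (E : H1 Ω →ₗ[ℂ] H1 (univ : Set (EuclideanSpace ℝ (Fin d)))) : Prop :=
  (∀ f : H1 Ω, ∀ᵐ x ∂(volume.restrict Ω),
    ((E f : L2 (univ : Set (EuclideanSpace ℝ (Fin d)))) : EuclideanSpace ℝ (Fin d) → ℂ) x
      = (f : L2 Ω) x) ∧
  h1OpNorm E < ⊤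

/-- The minimal extension constant `𝓔(Ω) = inf_E ‖E‖₁ ∈ [0, ∞]`, the infimum over all extension
operators. -/
def extConst {d : ℕ} (Ω : Set (EuclideanSpace ℝ (Fin d))) : ℝ≥0∞ :=
  ⨅ (E : H1 Ω →ₗ[ℂ] H1 (univ : Set (EuclideanSpace ℝ (Fin d)))) (_ : IsExtensionOperator E),
    h1OpNorm E

/-- The planar wedge `Ω_φ = {(x₁, x₂) : x₂ > cot(φ/2) |x₁|}` (coordinates indexed from `0`). -/
def wedge (φ : ℝ) : Set (EuclideanSpace ℝ (Fin 2)) :=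
  {x | x 1 > Real.cot (φ / 2) * |x 0|}

end

/-! A single function forces the bound. On the wedge take `f = κ exp(-x₁)` with `κ² = cot (φ/2)`,
which has `H¹` norm one. Put `a = cos (φ/2)`, `b = sin (φ/2)`. Outside the wedge, on each of its two
sides `σ = ±1`, lies the quadrant spanned by the boundary direction `(σ b, a)` and the outward
normal `(σ a, -b)`; let `s` and `n` be the corresponding coordinates. The two quadrants and the
wedge are pairwise disjoint.

Since `x₁ = a s` on the boundary ray, any extension `u` of `f` has boundary value `κ exp(-a s)`
there. On each normal half-line, `∫ (|∂ₙu|² + |u|²) dn ≥ |u(s, 0)|²`. Integrating in `s`, the energy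
in each quadrant is at least `κ² / (2a) = 1 / (2b)`. Adding both quadrants to the energy 1 on the
wedge gives `‖u‖₁² ≥ 1 + 1 / sin (φ/2)`.

Traces are avoided by duality. With the weight `e = exp(-a s - n)`, integration by parts formally
gives `∫ e (u - ∂ₙu) = κ / (2a)` over the quadrant (`integral_quadrant_eq`), and Young's inequality
turns this into the energy bound (`energy_quadrant_ge`). The identity is proved by subtracting the
globally defined exponential, so that the difference vanishes on the wedge, and testing with
functions from `exists_test_functions` whose support leaves the closed quadrant only into the wedge.
-/

noncomputable section

/-! ### Frame coordinates, exponential integrals and `L²` norms -/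

/-- The linear functional `x ↦ p x₀ + q x₁` on the Euclidean plane. -/
def linForm (p q : ℝ) : EuclideanSpace ℝ (Fin 2) →L[ℝ] ℝ :=
  p • EuclideanSpace.proj 0 + q • EuclideanSpace.proj 1

@[simp] theorem linForm_apply (p q : ℝ) (x : EuclideanSpace ℝ (Fin 2)) :
    linForm p q x = p * x 0 + q * x 1 := by
  simp [linForm]

theorem MeasureTheory.MeasurePreserving.integral_comp_of_aestronglyMeasurable {α β : Type*}
    [MeasurableSpace α] [MeasurableSpace β] {μ : Measure α} {ν : Measure β} {f : α → β}
    (hf : MeasurePreserving f μ ν) {g : β → ℝ} (hg : AEStronglyMeasurable g ν) :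
    ∫ x, g (f x) ∂μ = ∫ y, g y ∂ν := by
  rw [← hf.map_eq] at hg ⊢
  exact (integral_map hf.measurable.aemeasurable hg).symm

theorem volume_preserving_coords :
    MeasurePreserving (fun x : EuclideanSpace ℝ (Fin 2) => (x 0, x 1)) :=
  (volume_preserving_finTwoArrow ℝ).comp (PiLp.volume_preserving_ofLp (Fin 2))

/-- The coordinate map of an orthonormal frame of the plane preserves the volume. -/
theorem volume_preserving_frame {σ a b : ℝ} (hσ : σ ^ 2 = 1) (hab : a ^ 2 + b ^ 2 = 1) :
    MeasurePreserving (fun x : EuclideanSpace ℝ (Fin 2) =>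
      (linForm (σ * b) a x, linForm (σ * a) (-b) x)) := by
  let L : EuclideanSpace ℝ (Fin 2) →ₗ[ℝ] EuclideanSpace ℝ (Fin 2) :=
    { toFun := fun x => !₂[linForm (σ * b) a x, linForm (σ * a) (-b) x]
      map_add' := fun x y => by ext i; fin_cases i <;> simp only [map_add] <;> rfl
      map_smul' := fun c x => by ext i; fin_cases i <;> simp only [map_smul] <;> rfl }
  let I : EuclideanSpace ℝ (Fin 2) →ₗᵢ[ℝ] EuclideanSpace ℝ (Fin 2) :=
    { toLinearMap := L
      norm_map' := fun x => by
        have h : ‖L x‖ ^ 2 = ‖x‖ ^ 2 := by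
          simp only [EuclideanSpace.real_norm_sq_eq, Fin.sum_univ_two, L, LinearMap.coe_mk,
            AddHom.coe_mk, linForm_apply]
          simp only [Matrix.cons_val_zero, Matrix.cons_val_one]
          linear_combination (x 0 ^ 2 * (a ^ 2 + b ^ 2)) * hσ + (x 0 ^ 2 + x 1 ^ 2) * hab
        exact (pow_left_inj₀ (norm_nonneg _) (norm_nonneg _) two_ne_zero).1 h }
  exact volume_preserving_coords.comp (I.toLinearIsometryEquiv rfl).measurePreserving

/-- In frame coordinates the height is `a s - b n`, so `exp(-x₁)` grows like `exp(b n)` along the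
outward normal. -/
theorem snd_eq_frame (σ : ℝ) {a b : ℝ} (hab : a ^ 2 + b ^ 2 = 1)
    (x : EuclideanSpace ℝ (Fin 2)) :
    x 1 = a * linForm (σ * b) a x - b * linForm (σ * a) (-b) x := by
  simp only [linForm_apply]
  linear_combination (-x 1) * hab

/-- The open quadrant spanned by an orthonormal frame of the plane. -/
def quadrant (σ a b : ℝ) : Set (EuclideanSpace ℝ (Fin 2)) :=
  {x | 0 < linForm (σ * b) a x ∧ 0 < linForm (σ * a) (-b) x}

theorem isOpen_quadrant (σ a b : ℝ) : IsOpen (quadrant σ a b) :=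
  (isOpen_lt continuous_const (linForm _ _).continuous).inter
    (isOpen_lt continuous_const (linForm _ _).continuous)

/-- In frame coordinates the integral factors over `(0, ∞)²`. It is needed with `(p, q) = (2a, 2)`
for `e²` and `(2a, 1 - b)` for `e exp(-x₁)`. -/
theorem integral_exp_quadrant {σ a b : ℝ} (hσ : σ ^ 2 = 1) (hab : a ^ 2 + b ^ 2 = 1) {p q : ℝ}
    (hp : 0 < p) (hq : 0 < q) :
    IntegrableOn (fun x => Real.exp (-p * linForm (σ * b) a x + -q * linForm (σ * a) (-b) x))
      (quadrant σ a b) ∧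
    ∫ x in quadrant σ a b,
      Real.exp (-p * linForm (σ * b) a x + -q * linForm (σ * a) (-b) x) = 1 / (p * q) := by
  have hm := (volume_preserving_frame hσ hab).restrict_preimage
    (measurableSet_Ioi.prod measurableSet_Ioi : MeasurableSet (Ioi (0 : ℝ) ×ˢ Ioi (0 : ℝ)))
  have hi : Integrable (fun z : ℝ × ℝ => Real.exp (-p * z.1) * Real.exp (-q * z.2))
      (volume.restrict (Ioi (0 : ℝ) ×ˢ Ioi (0 : ℝ))) := by
    rw [Measure.volume_eq_prod, ← Measure.prod_restrict]
    exact (integrableOn_exp_mul_Ioi (by linarith) 0).mul_prod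
      (integrableOn_exp_mul_Ioi (by linarith) 0)
  simp only [Real.exp_add]
  refine ⟨hm.integrable_comp_of_integrable hi, ?_⟩
  refine (hm.integral_comp_of_aestronglyMeasurable hi.1).trans ?_
  rw [Measure.volume_eq_prod]
  refine (setIntegral_prod_mul (fun y => Real.exp (-p * y)) (fun y => Real.exp (-q * y))
    _ _).trans ?_
  rw [integral_exp_mul_Ioi (by linarith), integral_exp_mul_Ioi (by linarith)]
  simp
  ring

/-- Integrating first in the vertical direction leaves `exp(-2c|x|) / 2`. The value dictates the
normalisation `κ² = c` of the unit vector. -/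
theorem integral_exp_cone {c : ℝ} (hc : 0 < c) :
    IntegrableOn (fun x : EuclideanSpace ℝ (Fin 2) => Real.exp (-2 * x 1))
      {x | x 1 > c * |x 0|} ∧
    ∫ x in {x : EuclideanSpace ℝ (Fin 2) | x 1 > c * |x 0|}, Real.exp (-2 * x 1)
      = 1 / (2 * c) := by
  have hs : MeasurableSet {z : ℝ × ℝ | z.2 > c * |z.1|} :=
    (isOpen_lt (by fun_prop) (by fun_prop)).measurableSet
  have hm := volume_preserving_coords.restrict_preimage hs
  let F : ℝ × ℝ → ℝ := {z : ℝ × ℝ | z.2 > c * |z.1|}.indicator (fun z => Real.exp (-2 * z.2))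
  have hF : ∀ x, (fun y => F (x, y)) = (Ioi (c * |x|)).indicator (fun y => Real.exp (-2 * y)) :=
    fun x => rfl
  have hF0 : ∀ z, 0 ≤ F z := fun z => indicator_nonneg (fun _ _ => (Real.exp_pos _).le) z
  have hin : ∀ x, ∫ y, F (x, y) = Real.exp (-2 * c * |x|) / 2 := fun x => by
    rw [hF, integral_indicator measurableSet_Ioi, integral_exp_mul_Ioi (by norm_num)]
    ring_nf
  have hFm : Measurable F := (by fun_prop : Measurable _).indicator hs
  have habs : ∫ x : ℝ, Real.exp (-2 * c * |x|) = 1 / c := by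
    rw [integral_comp_abs (f := fun x => Real.exp (-2 * c * x)),
      integral_exp_mul_Ioi (by linarith)]
    simp
    field_simp
  have hFi : Integrable F := by
    rw [Measure.volume_eq_prod, integrable_prod_iff hFm.aestronglyMeasurable]
    refine ⟨ae_of_all _ fun x => ?_, ?_⟩
    · rw [hF, integrable_indicator_iff measurableSet_Ioi]
      exact integrableOn_exp_mul_Ioi (by norm_num) _
    · simp only [Real.norm_of_nonneg (hF0 _), hin]
      refine Integrable.div_const ?_ 2
      -- The Bochner integral of a non-integrable function is 0, so the nonzero value `1 / c`
      -- already gives integrability.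
      refine Integrable.of_integral_ne_zero ?_
      rw [habs]
      positivity
  refine ⟨hm.integrable_comp_of_integrable ((integrable_indicator_iff hs).1 hFi), ?_⟩
  refine (hm.integral_comp_of_aestronglyMeasurable
    (g := fun z : ℝ × ℝ => Real.exp (-2 * z.2)) (by fun_prop)).trans ?_
  rw [← integral_indicator hs, Measure.volume_eq_prod]
  refine (integral_prod F hFi).trans ?_
  simp only [hin]
  rw [integral_div, habs]
  field_simp

/-- The squared `L²` norm is the integral of the squared modulus. -/
theorem L2_norm_sq {d : ℕ} {Ω : Set (EuclideanSpace ℝ (Fin d))} (f : L2 Ω) :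
    ‖f‖ ^ 2 = ∫ x in Ω, ‖f x‖ ^ 2 := by
  have h := inner_self_eq_norm_sq_to_K (𝕜 := ℂ) f
  rw [L2.inner_def] at h
  simp only [inner_self_eq_norm_sq_to_K] at h
  have h2 : ∫ x in Ω, ((‖f x‖ ^ 2 : ℝ) : ℂ) = ((‖f‖ ^ 2 : ℝ) : ℂ) := by
    push_cast
    exact h
  rw [integral_complex_ofReal] at h2
  exact (Complex.ofReal_injective h2).symm

theorem L2_integrable_norm_sq {d : ℕ} {Ω : Set (EuclideanSpace ℝ (Fin d))} (f : L2 Ω) :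
    Integrable (fun x => ‖f x‖ ^ 2) (volume.restrict Ω) :=
  (Lp.memLp f).integrable_norm_pow (by norm_num)

/-! ### Cutoffs and test functions -/

theorem exists_bound_deriv_smoothTransition :
    ∃ C : ℝ, ∀ x, |deriv Real.smoothTransition x| ≤ C := by
  have hc : Continuous (deriv Real.smoothTransition) :=
    (Real.smoothTransition.contDiff (n := 1)).continuous_deriv (by simp)
  have hs : HasCompactSupport (deriv Real.smoothTransition) := by
    refine HasCompactSupport.intro (isCompact_Icc (a := (0 : ℝ)) (b := 1)) fun x hx => ?_
    rcases lt_or_ge x 0 with h | h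
    · have : Real.smoothTransition =ᶠ[𝓝 x] fun _ => 0 := by
        filter_upwards [Iio_mem_nhds h] with y hy
        exact Real.smoothTransition.zero_of_nonpos (le_of_lt hy)
      rw [this.deriv_eq, deriv_const]
    · have h1 : 1 < x := by
        by_contra h1
        exact hx ⟨h, not_lt.1 h1⟩
      have : Real.smoothTransition =ᶠ[𝓝 x] fun _ => 1 := by
        filter_upwards [Ioi_mem_nhds h1] with y hy
        exact Real.smoothTransition.one_of_one_le (le_of_lt hy)
      rw [this.deriv_eq, deriv_const]
  obtain ⟨C, hC⟩ := hs.exists_bound_of_continuous hc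
  exact ⟨C, hC⟩

/-- Smooth truncations of `n ↦ exp (-n)` on the half-line `n > 0`. -/
theorem exists_exp_cutoff : ∃ C : ℝ, ∀ (k δ : ℝ), 0 < δ → ∃ β : ℝ → ℝ, ContDiff ℝ ∞ β ∧
    (∀ n ≤ -δ, β n = 0) ∧ (∀ n ≥ k, β n = 0) ∧ ∀ n > 0, |β n| ≤ Real.exp (-n) ∧
      |deriv β n| ≤ C * Real.exp (-n) ∧
      (n + 1 < k → β n = Real.exp (-n) ∧ deriv β n = -Real.exp (-n)) := by
  obtain ⟨C, hC⟩ := exists_bound_deriv_smoothTransition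
  -- The cutoff at scale `δ` acts only on `-δ < n < 0`: its factor is identically 1 for `n > 0`.
  -- Hence the derivative bound there is independent of `δ`, as dominated convergence requires.
  refine ⟨1 + C, fun k δ hδ => ⟨fun n => Real.exp (-n) * Real.smoothTransition (k - n) *
    Real.smoothTransition (1 + n / δ), ?_, ?_, ?_, ?_⟩⟩
  · exact ((Real.contDiff_exp.comp contDiff_neg).mul
      (Real.smoothTransition.contDiff.comp (contDiff_const.sub contDiff_id))).mul
      (Real.smoothTransition.contDiff.comp (contDiff_const.add (contDiff_id.div_const _)))
  · intro n hn
    have : 1 + n / δ ≤ 0 := by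
      have : n / δ ≤ -1 := by rw [div_le_iff₀ hδ]; linarith
      linarith
    simp only [Real.smoothTransition.zero_of_nonpos this, mul_zero]
  · intro n hn
    simp only [Real.smoothTransition.zero_of_nonpos (sub_nonpos.2 hn), mul_zero, zero_mul]
  · intro n hn
    have hloc : ∀ m > 0, Real.exp (-m) * Real.smoothTransition (k - m) *
        Real.smoothTransition (1 + m / δ) = Real.exp (-m) * Real.smoothTransition (k - m) := by
      intro m hm
      rw [Real.smoothTransition.one_of_one_le (x := 1 + m / δ)
        (by have := div_pos hm hδ; linarith), mul_one]
    have hd : deriv (fun n => Real.exp (-n) * Real.smoothTransition (k - n) *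
        Real.smoothTransition (1 + n / δ)) n = -Real.exp (-n) * Real.smoothTransition (k - n)
          - Real.exp (-n) * deriv Real.smoothTransition (k - n) := by
      have he : (fun n => Real.exp (-n) * Real.smoothTransition (k - n) *
          Real.smoothTransition (1 + n / δ)) =ᶠ[𝓝 n]
          fun n => Real.exp (-n) * Real.smoothTransition (k - n) := by
        filter_upwards [Ioi_mem_nhds hn] with m hm using hloc m hm
      rw [he.deriv_eq]
      have h1 : HasDerivAt (fun n => Real.exp (-n)) (Real.exp (-n) * (-1)) n :=
        (hasDerivAt_neg n).exp
      have h2 : HasDerivAt (fun n => Real.smoothTransition (k - n))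
          (deriv Real.smoothTransition (k - n) * (-1)) n := by
        have h3 : DifferentiableAt ℝ Real.smoothTransition (k - n) :=
          (Real.smoothTransition.contDiff (n := 1)).differentiable (by simp) _
        exact h3.hasDerivAt.comp n ((hasDerivAt_id n).const_sub k)
      refine (h1.mul h2).deriv.trans ?_
      ring
    have hT0 := Real.smoothTransition.nonneg (k - n)
    have hT1 := Real.smoothTransition.le_one (k - n)
    have he := Real.exp_pos (-n)
    refine ⟨?_, ?_, fun hk => ?_⟩
    · simp only
      rw [hloc n hn, abs_of_nonneg (by positivity)]
      nlinarith
    · rw [hd]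
      calc _ = Real.exp (-n) * |Real.smoothTransition (k - n) +
              deriv Real.smoothTransition (k - n)| := by
            rw [← abs_of_pos he, ← abs_mul, ← abs_neg, abs_of_pos he]
            congr 1
            ring
        _ ≤ Real.exp (-n) * (1 + C) := by
            gcongr
            refine (abs_add_le _ _).trans (add_le_add ?_ (hC _))
            rwa [abs_of_nonneg hT0]
        _ = _ := mul_comm _ _
    · have h1 : Real.smoothTransition =ᶠ[𝓝 (k - n)] fun _ => 1 := by
        filter_upwards [Ioi_mem_nhds (show 1 < k - n by linarith)] with y hy
        exact Real.smoothTransition.one_of_one_le (le_of_lt hy)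
      simp only
      rw [hd, hloc n hn, h1.deriv_eq, h1.eq_of_nhds, deriv_const]
      simp

/-- Smooth truncations of `s ↦ exp (-a s)` supported in compact subsets of the half-line. -/
theorem exists_exp_bump (a k : ℝ) (hk : 0 ≤ k) : ∃ α : ℝ → ℝ, ContDiff ℝ ∞ α ∧
    (∀ s ≤ 1 / (k + 1), α s = 0) ∧ (∀ s ≥ k, α s = 0) ∧ (∀ s, |α s| ≤ Real.exp (-a * s)) ∧
      ∀ s, 2 ≤ (k + 1) * s → s + 1 ≤ k → α s = Real.exp (-a * s) := by
  -- The factor `k + 1` keeps the scale positive at `k = 0`; the first transition takes place for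
  -- `(k + 1) s` between 1 and 2.
  refine ⟨fun s => Real.exp (-a * s) * Real.smoothTransition ((k + 1) * s - 1) *
    Real.smoothTransition (k - s), ?_, ?_, ?_, ?_, ?_⟩
  · exact ((Real.contDiff_exp.comp (contDiff_const.mul contDiff_id)).mul
      (Real.smoothTransition.contDiff.comp
        ((contDiff_const.mul contDiff_id).sub contDiff_const))).mul
      (Real.smoothTransition.contDiff.comp (contDiff_const.sub contDiff_id))
  · intro s hs
    have : (k + 1) * s - 1 ≤ 0 := by
      rw [le_div_iff₀ (by linarith)] at hs
      linarith
    simp only [Real.smoothTransition.zero_of_nonpos this, mul_zero, zero_mul]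
  · intro s hs
    simp only [Real.smoothTransition.zero_of_nonpos (sub_nonpos.2 hs), mul_zero]
  · intro s
    have h0 := Real.smoothTransition.nonneg (k - s)
    have h1 := Real.smoothTransition.nonneg ((k + 1) * s - 1)
    have he := Real.exp_pos (-a * s)
    simp only
    rw [abs_of_nonneg (by positivity), mul_assoc]
    exact mul_le_of_le_one_right he.le
      (mul_le_one₀ (Real.smoothTransition.le_one _) h0 (Real.smoothTransition.le_one _))
  · intro s h1 h2
    simp only
    rw [Real.smoothTransition.one_of_one_le (by linarith),
      Real.smoothTransition.one_of_one_le (by linarith), mul_one, mul_one]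

/-- Test functions approximating `exp (-a s - n)` in the open quadrant and vanishing outside the
quadrant and the adjacent cone. -/
theorem exists_test_functions {σ a b : ℝ} (hσ : σ ^ 2 = 1) (hab : a ^ 2 + b ^ 2 = 1) (ha : 0 < a)
    (hb : 0 < b) : ∃ (C : ℝ) (V : ℕ → EuclideanSpace ℝ (Fin 2) → ℝ), ∀ k,
      ContDiff ℝ ∞ (V k) ∧ HasCompactSupport (V k) ∧
      (∀ x, x ∉ quadrant σ a b → linForm (σ * a) (-b) x ≠ 0 →
        ¬ (linForm (σ * a) (-b) x < 0 ∧ linForm (-(σ * a)) (-b) x < 0) →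
        V k x = 0 ∧ fderiv ℝ (V k) x !₂[σ * a, -b] = 0) ∧
      ∀ x ∈ quadrant σ a b,
        |V k x| ≤ Real.exp (-a * linForm (σ * b) a x + -1 * linForm (σ * a) (-b) x) ∧
        |fderiv ℝ (V k) x !₂[σ * a, -b]| ≤
          C * Real.exp (-a * linForm (σ * b) a x + -1 * linForm (σ * a) (-b) x) ∧
        (2 ≤ (k + 1) * linForm (σ * b) a x → linForm (σ * b) a x + 1 ≤ k →
          linForm (σ * a) (-b) x + 1 < k →
          V k x = Real.exp (-a * linForm (σ * b) a x + -1 * linForm (σ * a) (-b) x) ∧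
          fderiv ℝ (V k) x !₂[σ * a, -b] =
            -Real.exp (-a * linForm (σ * b) a x + -1 * linForm (σ * a) (-b) x)) := by
  obtain ⟨C, hC⟩ := exists_exp_cutoff
  choose α hαs hα0 hαk hαb hαe using fun k : ℕ => exists_exp_bump a k (Nat.cast_nonneg k)
  -- The overhang into `n < 0` is matched to the lower cutoff `s > 1 / (k + 1)`: with this `δ`, the
  -- part of the support in `n < 0` stays inside the wedge.
  have hδ : ∀ k : ℕ, 0 < 2 * a * b / (k + 1) := fun k => by positivity
  choose β hβs hβ0 hβk hβ using fun k : ℕ => hC k _ (hδ k)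
  refine ⟨C, fun k x => α k (linForm (σ * b) a x) * β k (linForm (σ * a) (-b) x), fun k => ?_⟩
  have hder : ∀ x, fderiv ℝ (fun x => α k (linForm (σ * b) a x) * β k (linForm (σ * a) (-b) x)) x
      !₂[σ * a, -b] = α k (linForm (σ * b) a x) * deriv (β k) (linForm (σ * a) (-b) x) := by
    intro x
    have h1 : HasFDerivAt (fun x => α k (linForm (σ * b) a x))
        (deriv (α k) (linForm (σ * b) a x) • linForm (σ * b) a) x :=
      (((hαs k).differentiable (by simp) _).hasDerivAt).comp_hasFDerivAt x
        (linForm (σ * b) a).hasFDerivAt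
    have h2 : HasFDerivAt (fun x => β k (linForm (σ * a) (-b) x))
        (deriv (β k) (linForm (σ * a) (-b) x) • linForm (σ * a) (-b)) x :=
      (((hβs k).differentiable (by simp) _).hasDerivAt).comp_hasFDerivAt x
        (linForm (σ * a) (-b)).hasFDerivAt
    refine (congrArg (fun L => L !₂[σ * a, -b]) (h1.mul h2).fderiv).trans ?_
    have e1 : linForm (σ * b) a !₂[σ * a, -b] = 0 := by
      simp
      linear_combination (a * b) * hσ
    have e2 : linForm (σ * a) (-b) !₂[σ * a, -b] = 1 := by
      simp
      linear_combination (a ^ 2) * hσ + hab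
    simp only [add_apply, smul_apply, e1, e2, smul_eq_mul]
    ring
  have hnorm : ∀ x : EuclideanSpace ℝ (Fin 2),
      ‖x‖ ^ 2 = linForm (σ * b) a x ^ 2 + linForm (σ * a) (-b) x ^ 2 := by
    intro x
    simp only [EuclideanSpace.real_norm_sq_eq, Fin.sum_univ_two, linForm_apply]
    linear_combination (-x 0 ^ 2 * (a ^ 2 + b ^ 2)) * hσ - (x 0 ^ 2 + x 1 ^ 2) * hab
  have hαneg : ∀ s ≤ 0, α k s = 0 := fun s hs => hα0 k s (hs.trans (by positivity))
  refine ⟨?_, ?_, ?_, ?_⟩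
  · exact ((hαs k).comp (linForm _ _).contDiff).mul ((hβs k).comp (linForm _ _).contDiff)
  · refine HasCompactSupport.intro
      (isCompact_closedBall (0 : EuclideanSpace ℝ (Fin 2)) (2 * k + 2 * a * b / (k + 1)))
      fun x hx => ?_
    have hδk := hδ k
    have hβδ := hβ0 k
    have hk0 : (0 : ℝ) ≤ k := Nat.cast_nonneg k
    generalize 2 * a * b / ((k : ℝ) + 1) = δ at *
    by_contra hne
    obtain ⟨h1, h2⟩ := mul_ne_zero_iff.1 hne
    have s0 : 0 < linForm (σ * b) a x := not_le.1 fun h => h1 (hαneg _ h)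
    have s1 : linForm (σ * b) a x < k := not_le.1 fun h => h1 (hαk k _ h)
    have n0 : -δ < linForm (σ * a) (-b) x := not_le.1 fun h => h2 (hβδ _ h)
    have n1 : linForm (σ * a) (-b) x < k := not_le.1 fun h => h2 (hβk k _ h)
    refine hx (mem_closedBall_zero_iff.2 ?_)
    refine (sq_le_sq₀ (norm_nonneg _) (by positivity)).1 ?_
    rw [hnorm]
    have hs2 : linForm (σ * b) a x ^ 2 ≤ k ^ 2 := by gcongr
    have hn2 : linForm (σ * a) (-b) x ^ 2 ≤ (k + δ) ^ 2 :=
      sq_le_sq' (by linarith) (by linarith)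
    nlinarith
  · intro x hxS hn hxΩ
    rw [hder]
    by_cases hs : linForm (σ * b) a x ≤ 1 / (k + 1)
    · simp only [hα0 k _ hs, zero_mul, and_self]
    push Not at hs
    have hs0 : 0 < linForm (σ * b) a x := lt_trans (by positivity) hs
    have hneg : linForm (σ * a) (-b) x < 0 := lt_of_le_of_ne (not_lt.1 fun h => hxS ⟨hs0, h⟩) hn
    have hlt : linForm (σ * a) (-b) x < -(2 * a * b / (k + 1)) := by
      by_contra h
      push Not at h
      refine hxΩ ⟨hneg, ?_⟩
      -- The normal coordinate of the other side of the wedge, written in this frame. Since `|a² -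
      -- b²| ≤ 1`, it is negative as soon as `|n| ≤ δ < 2ab s`.
      have e : linForm (-(σ * a)) (-b) x = -(2 * a * b) * linForm (σ * b) a x
          - (a ^ 2 - b ^ 2) * linForm (σ * a) (-b) x := by
        simp only [linForm_apply]
        linear_combination (σ * a * x 0 + b * x 1) * hab
      rw [e]
      have h1 : 2 * a * b * (1 / (k + 1)) < 2 * a * b * linForm (σ * b) a x := by gcongr
      have h2 : 2 * a * b * (1 / ((k : ℝ) + 1)) = 2 * a * b / (k + 1) := by ring
      nlinarith [sq_nonneg a, sq_nonneg b]
    have hz : β k =ᶠ[𝓝 (linForm (σ * a) (-b) x)] fun _ => 0 := by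
      filter_upwards [Iio_mem_nhds hlt] with y hy using hβ0 k y (le_of_lt hy)
    simp only
    rw [hz.eq_of_nhds, hz.deriv_eq, deriv_const]
    simp
  · intro x hx
    obtain ⟨b1, b2, b3⟩ := hβ k _ hx.2
    have ha1 := hαb k (linForm (σ * b) a x)
    rw [hder]
    simp only [Real.exp_add, neg_one_mul]
    refine ⟨?_, ?_, fun h1 h2 h3 => ?_⟩
    · rw [abs_mul]
      gcongr
    · rw [abs_mul, mul_left_comm]
      gcongr
    · rw [hαe k _ h1 h2, (b3 h3).1, (b3 h3).2]
      simp

/-! ### The exponential on the plane -/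

/-- The complex-valued function `x ↦ κ exp (-x₁)`. -/
def expFun (κ : ℝ) (x : EuclideanSpace ℝ (Fin 2)) : ℂ := ((κ * Real.exp (-x 1) : ℝ) : ℂ)

theorem hasFDerivAt_expFun (κ : ℝ) (x : EuclideanSpace ℝ (Fin 2)) :
    HasFDerivAt (expFun κ)
      (Complex.ofRealCLM.comp ((-(κ * Real.exp (-x 1))) • EuclideanSpace.proj (𝕜 := ℝ) 1)) x := by
  have h1 : HasFDerivAt (fun x : EuclideanSpace ℝ (Fin 2) => x 1)
      (EuclideanSpace.proj (𝕜 := ℝ) 1) x :=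
    (EuclideanSpace.proj (𝕜 := ℝ) (1 : Fin 2) : EuclideanSpace ℝ (Fin 2) →L[ℝ] ℝ).hasFDerivAt
  have h2 : HasFDerivAt (fun x : EuclideanSpace ℝ (Fin 2) => κ * Real.exp (-x 1))
      ((-(κ * Real.exp (-x 1))) • EuclideanSpace.proj (𝕜 := ℝ) 1) x := by
    refine (h1.neg.exp.const_mul κ).congr_fderiv ?_
    ext v
    simp
    ring
  exact Complex.ofRealCLM.hasFDerivAt.comp x h2

theorem fderiv_expFun_apply (κ : ℝ) (x v : EuclideanSpace ℝ (Fin 2)) :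
    fderiv ℝ (expFun κ) x v = -(v 1 : ℂ) * expFun κ x := by
  rw [(hasFDerivAt_expFun κ x).fderiv]
  simp [expFun]
  ring

theorem continuous_expFun (κ : ℝ) : Continuous (expFun κ) := by
  unfold expFun
  fun_prop

theorem norm_expFun (κ : ℝ) (x : EuclideanSpace ℝ (Fin 2)) :
    ‖expFun κ x‖ = |κ| * Real.exp (-x 1) := by
  rw [expFun, Complex.norm_real, Real.norm_eq_abs, abs_mul, abs_of_pos (Real.exp_pos _)]

theorem integral_fderiv_smul_expFun (κ : ℝ) {ψ : EuclideanSpace ℝ (Fin 2) → ℝ}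
    (hψ : ContDiff ℝ ∞ ψ) (hc : HasCompactSupport ψ) (v : EuclideanSpace ℝ (Fin 2)) :
    ∫ x, fderiv ℝ ψ x v • expFun κ x = -∫ x, ψ x • (-(v 1 : ℂ) * expFun κ x) := by
  have hd := continuous_partial hψ v
  have h := integral_smul_fderiv_eq_neg_fderiv_smul_of_integrable (μ := volume) (f := ψ)
    (g := expFun κ) (v := v)
    ((hd.smul (continuous_expFun κ)).integrable_of_hasCompactSupport
      ((hc.fderiv_apply (𝕜 := ℝ) v).smul_right))
    (by
      simp only [fderiv_expFun_apply]
      exact (hψ.continuous.smul (continuous_const.mul (continuous_expFun κ)))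
        |>.integrable_of_hasCompactSupport hc.smul_right)
    ((hψ.continuous.smul (continuous_expFun κ)).integrable_of_hasCompactSupport hc.smul_right)
    (fun x _ => hψ.differentiable (by simp) x)
    (fun x _ => (hasFDerivAt_expFun κ x).differentiableAt)
  simp only [fderiv_expFun_apply] at h
  rw [h, neg_neg]

/-- The kernel is a proper subspace, hence null. This discards the line `n = 0`, which lies in
neither the open quadrant nor the wedge. -/
theorem ae_linForm_ne_zero {p q : ℝ} (h : p ^ 2 + q ^ 2 = 1) :
    ∀ᵐ x : EuclideanSpace ℝ (Fin 2), linForm p q x ≠ 0 := by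
  have hne : LinearMap.ker (linForm p q).toLinearMap ≠ ⊤ := by
    intro ht
    have : !₂[p, q] ∈ LinearMap.ker (linForm p q).toLinearMap := ht ▸ Submodule.mem_top
    have h0 : linForm p q !₂[p, q] = 0 := this
    rw [linForm_apply] at h0
    simp only [Matrix.cons_val_zero, Matrix.cons_val_one] at h0
    nlinarith
  have := Measure.addHaar_submodule volume _ hne
  rw [ae_iff]
  exact (congrArg volume (Set.ext fun x => not_not)).trans this

/-! ### Energy in one quadrant -/

/-- The boundary identity in a quadrant, for a function with square-integrable normal derivative
that agrees with `κ exp (-x₁)` on the adjacent cone. -/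
theorem integral_quadrant_eq {σ a b κ : ℝ} (hσ : σ ^ 2 = 1) (hab : a ^ 2 + b ^ 2 = 1) (ha : 0 < a)
    (hb : 0 < b) {u un : EuclideanSpace ℝ (Fin 2) → ℂ} (hu : MemLp u 2 volume)
    (hun : MemLp un 2 volume)
    (hw : ∀ ψ : EuclideanSpace ℝ (Fin 2) → ℝ, ContDiff ℝ ∞ ψ → HasCompactSupport ψ →
      ∫ x, fderiv ℝ ψ x !₂[σ * a, -b] • u x = -∫ x, ψ x • un x)
    (huc : ∀ᵐ x : EuclideanSpace ℝ (Fin 2), linForm (σ * a) (-b) x < 0 →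
      linForm (-(σ * a)) (-b) x < 0 → u x = expFun κ x ∧ un x = b * expFun κ x) :
    IntegrableOn (fun x => Real.exp (-a * linForm (σ * b) a x + -1 * linForm (σ * a) (-b) x) •
      (u x - un x)) (quadrant σ a b) ∧
    ∫ x in quadrant σ a b, Real.exp (-a * linForm (σ * b) a x + -1 * linForm (σ * a) (-b) x) •
      (u x - un x) = ((κ / (2 * a) : ℝ) : ℂ) := by
  -- The multiple `κ e` is the minimiser of `∫ (|∂ₙu|² + |u|²) dn` with boundary value `κ exp(-a
  -- s)`, which is why this weight loses nothing.
  set e : EuclideanSpace ℝ (Fin 2) → ℝ :=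
    fun x => Real.exp (-a * linForm (σ * b) a x + -1 * linForm (σ * a) (-b) x) with he
  set S := quadrant σ a b
  have hb1 : b < 1 := by nlinarith
  have hec : Continuous e := by fun_prop
  have hS : MeasurableSet S := (isOpen_quadrant _ _ _).measurableSet
  have heL : MemLp e 2 (volume.restrict S) := by
    rw [memLp_two_iff_integrable_sq hec.aestronglyMeasurable]
    refine (integral_exp_quadrant hσ hab (p := 2 * a) (q := 2) (by positivity)
      two_pos).1.congr (ae_of_all _ fun x => ?_)
    simp only [he, ← Real.exp_nat_mul]
    congr 1
    push_cast
    ring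
  have heu : IntegrableOn (fun x => e x • u x) S := memLp_one_iff_integrable.1 ((hu.restrict S).smul heL)
  have heun : IntegrableOn (fun x => e x • un x) S := memLp_one_iff_integrable.1 ((hun.restrict S).smul heL)
  -- The exponential is not square integrable on the quadrant, but `e exp(-x₁) = exp(-2a s - (1 - b)
  -- n)` is integrable because `b < 1`.
  obtain ⟨hqi, hqe⟩ := integral_exp_quadrant hσ hab (p := 2 * a) (q := 1 - b) (by positivity)
    (by linarith)
  have hef' : ∀ x, e x • expFun κ x = ((κ * Real.exp (-(2 * a) * linForm (σ * b) a x +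
      -(1 - b) * linForm (σ * a) (-b) x) : ℝ) : ℂ) := by
    intro x
    rw [expFun, Complex.real_smul, ← Complex.ofReal_mul, mul_left_comm,
      snd_eq_frame σ hab x, he]
    simp only
    rw [← Real.exp_add]
    ring_nf
  have hef : IntegrableOn (fun x => e x • expFun κ x) S := by
    simp only [hef']
    exact (hqi.const_mul κ).ofReal
  have hefi : ∫ x in S, e x • expFun κ x = ((κ * (1 / (2 * a * (1 - b))) : ℝ) : ℂ) := by
    simp only [hef']
    rw [integral_complex_ofReal, integral_const_mul, hqe]
  -- Both `w` and its normal derivative `wn` vanish a.e. on the wedge; the factor `b` is the effect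
  -- of `∂ₙ` on `exp(-x₁)`.
  set w : EuclideanSpace ℝ (Fin 2) → ℂ := fun x => u x - expFun κ x with hwdef
  set wn : EuclideanSpace ℝ (Fin 2) → ℂ := fun x => un x - b * expFun κ x with hwndef
  have hew : IntegrableOn (fun x => e x • w x) S := by
    simp only [hwdef, smul_sub]
    exact heu.sub hef
  have hewn : IntegrableOn (fun x => e x • wn x) S := by
    have h : IntegrableOn (fun x => e x • ((b : ℂ) * expFun κ x)) S := by
      simp only [← mul_smul_comm]
      exact hef.const_mul (b : ℂ)
    simp only [hwndef, smul_sub]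
    exact heun.sub h
  obtain ⟨C, V, hV⟩ := exists_test_functions hσ hab ha hb
  have hlu : LocallyIntegrable u := hu.locallyIntegrable (by norm_num)
  have hlun : LocallyIntegrable un := hun.locallyIntegrable (by norm_num)
  -- Over the whole plane this is the weak derivative identity. Outside the quadrant the integrand
  -- vanishes a.e.: `w` and `wn` do on the wedge, the test function and its normal derivative
  -- elsewhere off the line `n = 0`.
  have hzero : ∀ k, ∫ x in S, (fderiv ℝ (V k) x !₂[σ * a, -b] • w x + V k x • wn x) = 0 := by
    intro k
    obtain ⟨hVs, hVc, hV0, -⟩ := hV k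
    have hd := continuous_partial hVs !₂[σ * a, -b]
    have hdc := hVc.fderiv_apply (𝕜 := ℝ) !₂[σ * a, -b]
    have hcf : Continuous fun x => (b : ℂ) * expFun κ x :=
      continuous_const.mul (continuous_expFun κ)
    have i1 := hlu.integrable_smul_left_of_hasCompactSupport hd hdc
    have i2 := (continuous_expFun κ).locallyIntegrable (μ := volume)
      |>.integrable_smul_left_of_hasCompactSupport hd hdc
    have i3 := hlun.integrable_smul_left_of_hasCompactSupport hVs.continuous hVc
    have i4 := hcf.locallyIntegrable (μ := volume)
      |>.integrable_smul_left_of_hasCompactSupport hVs.continuous hVc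
    have htot : ∫ x, (fderiv ℝ (V k) x !₂[σ * a, -b] • w x + V k x • wn x) = 0 := by
      simp only [hwdef, hwndef, smul_sub]
      rw [integral_add (by exact i1.sub i2) (by exact i3.sub i4), integral_sub i1 i2, integral_sub i3 i4,
        hw _ hVs hVc, integral_fderiv_smul_expFun κ hVs hVc]
      simp
    rw [← htot]
    refine setIntegral_eq_integral_of_ae_compl_eq_zero ?_
    filter_upwards [huc, ae_linForm_ne_zero (p := σ * a) (q := -b)
      (by linear_combination a ^ 2 * hσ + hab)] with x hx hn hxS
    by_cases hΩ : linForm (σ * a) (-b) x < 0 ∧ linForm (-(σ * a)) (-b) x < 0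
    · obtain ⟨h1, h2⟩ := hx hΩ.1 hΩ.2
      simp [hwdef, hwndef, h1, h2]
    · obtain ⟨h1, h2⟩ := hV0 x hxS hn hΩ
      rw [h1, h2, zero_smul, zero_smul, add_zero]
  have hlim : Tendsto (fun k => ∫ x in S, (fderiv ℝ (V k) x !₂[σ * a, -b] • w x + V k x • wn x))
      atTop (𝓝 (∫ x in S, (-e x • w x + e x • wn x))) := by
    refine tendsto_integral_of_dominated_convergence
      (fun x => C * ‖e x • w x‖ + ‖e x • wn x‖) ?_ ?_ ?_ ?_
    · intro k
      have hcf := continuous_expFun κ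
      have m1 := (continuous_partial (hV k).1 !₂[σ * a, -b]).aestronglyMeasurable
        (μ := volume.restrict S)
      have m2 := (hV k).1.continuous.aestronglyMeasurable (μ := volume.restrict S)
      have m3 := hu.restrict S |>.1
      have m4 := hun.restrict S |>.1
      have m5 := hcf.aestronglyMeasurable (μ := volume.restrict S)
      exact (m1.smul (m3.sub m5)).add (m2.smul (m4.sub (m5.const_mul _)))
    · exact (hew.norm.const_mul C).add hewn.norm
    · intro k
      filter_upwards [ae_restrict_mem hS] with x hx
      obtain ⟨h1, h2, -⟩ := (hV k).2.2.2 x hx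
      have hpos : 0 < e x := Real.exp_pos _
      refine (norm_add_le _ _).trans ?_
      simp only [norm_smul, Real.norm_eq_abs, abs_of_pos hpos]
      rw [← mul_assoc]
      gcongr
    · filter_upwards [ae_restrict_mem hS] with x hx
      refine tendsto_const_nhds.congr' ?_
      have t1 : ∀ᶠ k : ℕ in atTop, 2 / linForm (σ * b) a x ≤ k :=
        tendsto_natCast_atTop_atTop.eventually_ge_atTop _
      have t2 : ∀ᶠ k : ℕ in atTop, linForm (σ * b) a x + 1 ≤ k :=
        tendsto_natCast_atTop_atTop.eventually_ge_atTop _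
      have t3 : ∀ᶠ k : ℕ in atTop, linForm (σ * a) (-b) x + 1 < k :=
        tendsto_natCast_atTop_atTop.eventually_gt_atTop _
      filter_upwards [t1, t2, t3] with k h1 h2 h3
      have hs : 0 < linForm (σ * b) a x := hx.1
      rw [div_le_iff₀ hs] at h1
      obtain ⟨g1, g2⟩ := ((hV k).2.2.2 x hx).2.2 (by linarith) h2 h3
      rw [g1, g2]
  simp only [hzero] at hlim
  have hfin := tendsto_nhds_unique hlim tendsto_const_nhds
  refine ⟨by simp only [smul_sub]; exact heu.sub heun, ?_⟩
  -- Only the exponential contributes: the term in `w` and `wn` integrates to 0 by the limit above,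
  -- and the factor `1 - b` cancels against the integral of `e exp(-x₁)`.
  have hbw : ∀ x, e x • (u x - un x) =
      (1 - b : ℂ) * (e x • expFun κ x) - (-e x • w x + e x • wn x) := by
    intro x
    simp only [hwdef, hwndef, Complex.real_smul, neg_smul]
    ring
  refine (integral_congr_ae (ae_of_all _ hbw)).trans ?_
  rw [integral_sub (hef.const_mul _) (by simp only [neg_smul]; exact hew.neg.add hewn), hfin,
    sub_zero, integral_const_mul, hefi]
  have : (1 - b : ℂ) = ((1 - b : ℝ) : ℂ) := by push_cast; rfl
  rw [this, ← Complex.ofReal_mul]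
  congr 1
  have : 1 - b ≠ 0 := by linarith
  field_simp

/-- Lower bound for the energy in a quadrant. -/
theorem energy_quadrant_ge {σ a b κ : ℝ} (hσ : σ ^ 2 = 1) (hab : a ^ 2 + b ^ 2 = 1) (ha : 0 < a)
    (hb : 0 < b) (hκ : 0 < κ) {u g₀ g₁ : EuclideanSpace ℝ (Fin 2) → ℂ} (hu : MemLp u 2 volume)
    (hg₀ : MemLp g₀ 2 volume) (hg₁ : MemLp g₁ 2 volume)
    (h₀ : IsWeakPartial univ 0 u g₀) (h₁ : IsWeakPartial univ 1 u g₁)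
    (huc : ∀ᵐ x : EuclideanSpace ℝ (Fin 2), linForm (σ * a) (-b) x < 0 →
      linForm (-(σ * a)) (-b) x < 0 → u x = expFun κ x ∧ g₀ x = 0 ∧ g₁ x = -expFun κ x) :
    κ ^ 2 / (2 * a) ≤ ∫ x in quadrant σ a b, (‖g₀ x‖ ^ 2 + ‖g₁ x‖ ^ 2 + ‖u x‖ ^ 2) := by
  set un : EuclideanSpace ℝ (Fin 2) → ℂ := fun x => (σ * a) • g₀ x + (-b) • g₁ x with hun_def
  have hun : MemLp un 2 volume := (hg₀.const_smul (σ * a)).add (hg₁.const_smul (-b))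
  have hw : ∀ ψ : EuclideanSpace ℝ (Fin 2) → ℝ, ContDiff ℝ ∞ ψ → HasCompactSupport ψ →
      ∫ x, fderiv ℝ ψ x !₂[σ * a, -b] • u x = -∫ x, ψ x • un x := by
    intro ψ hψ hc
    have e0 := h₀ ψ hψ hc (subset_univ _)
    have e1 := h₁ ψ hψ hc (subset_univ _)
    rw [setIntegral_univ, setIntegral_univ] at e0 e1
    have hi : ∀ v, Integrable fun x => fderiv ℝ ψ x v • u x := fun v =>
      (hu.locallyIntegrable (by norm_num)).integrable_smul_left_of_hasCompactSupport
        (continuous_partial hψ v) (hc.fderiv_apply (𝕜 := ℝ) v)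
    have hig : ∀ {g : EuclideanSpace ℝ (Fin 2) → ℂ}, MemLp g 2 volume →
        Integrable fun x => ψ x • g x := fun hg =>
      (hg.locallyIntegrable (by norm_num)).integrable_smul_left_of_hasCompactSupport
        hψ.continuous hc
    have hv : !₂[σ * a, -b] = (σ * a) • EuclideanSpace.single (0 : Fin 2) (1 : ℝ) +
        (-b) • EuclideanSpace.single (1 : Fin 2) (1 : ℝ) := by
      ext i
      fin_cases i <;> simp
    have hL : ∀ x, fderiv ℝ ψ x !₂[σ * a, -b] • u x =
        (σ * a) • (fderiv ℝ ψ x (EuclideanSpace.single 0 1) • u x) +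
        (-b) • (fderiv ℝ ψ x (EuclideanSpace.single 1 1) • u x) := by
      intro x
      rw [hv, map_add, map_smul, map_smul, add_smul, smul_assoc, smul_assoc]
    have hR : ∀ x, ψ x • un x = (σ * a) • (ψ x • g₀ x) + (-b) • (ψ x • g₁ x) := by
      intro x
      rw [hun_def, smul_add, smul_comm (ψ x), smul_comm (ψ x)]
    simp only [hL, hR]
    rw [integral_add (by exact (hi _).smul (σ * a)) (by exact (hi _).smul (-b)),
      integral_add (by exact (hig hg₀).smul (σ * a)) (by exact (hig hg₁).smul (-b)),
      integral_smul, integral_smul, integral_smul, integral_smul, e0, e1]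
    simp only [smul_neg]
    ring
  obtain ⟨hint, heq⟩ := integral_quadrant_eq hσ hab ha hb hu hun hw (by
    filter_upwards [huc] with x hx h1 h2
    obtain ⟨q1, q2, q3⟩ := hx h1 h2
    refine ⟨q1, ?_⟩
    simp [hun_def, q2, q3])
  set e : EuclideanSpace ℝ (Fin 2) → ℝ :=
    fun x => Real.exp (-a * linForm (σ * b) a x + -1 * linForm (σ * a) (-b) x) with he
  set S := quadrant σ a b
  obtain ⟨hi2, he2⟩ := integral_exp_quadrant hσ hab (p := 2 * a) (q := 2) (by positivity) two_pos
  have hE : Integrable (fun x => ‖g₀ x‖ ^ 2 + ‖g₁ x‖ ^ 2 + ‖u x‖ ^ 2) (volume.restrict S) :=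
    (((hg₀.integrable_norm_pow (by norm_num)).add (hg₁.integrable_norm_pow (by norm_num))).add
      (hu.integrable_norm_pow (by norm_num))).restrict
  -- Young's inequality `κ e t ≤ κ² e² + t² / 4` with `t = |u| + |∂ₙu|`, followed by `t² ≤ 2 (|u|² +
  -- |∂ₙu|²)` and `|∂ₙu| ≤ |∇u|`. After integration the `e²` term is `κ² / (4a)`, half of the left
  -- side.
  have hpt : ∀ x, κ * ‖e x • (u x - un x)‖ ≤ κ ^ 2 * Real.exp (-(2 * a) * linForm (σ * b) a x +
      -2 * linForm (σ * a) (-b) x) + (‖g₀ x‖ ^ 2 + ‖g₁ x‖ ^ 2 + ‖u x‖ ^ 2) / 2 := by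
    intro x
    have hsq : Real.exp (-(2 * a) * linForm (σ * b) a x + -2 * linForm (σ * a) (-b) x)
        = e x ^ 2 := by
      simp only [he, ← Real.exp_nat_mul]
      congr 1
      push_cast
      ring
    have hpos : 0 < e x := Real.exp_pos _
    have h1 : ‖un x‖ ≤ a * ‖g₀ x‖ + b * ‖g₁ x‖ := by
      refine (norm_add_le _ _).trans (le_of_eq ?_)
      have : |σ| = 1 := by rw [← sq_eq_sq₀ (abs_nonneg _) zero_le_one, sq_abs, hσ, one_pow]
      rw [norm_smul, norm_smul, Real.norm_eq_abs, Real.norm_eq_abs, abs_mul, this, abs_neg,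
        abs_of_pos ha, abs_of_pos hb, one_mul]
    have h2 : ‖un x‖ ^ 2 ≤ ‖g₀ x‖ ^ 2 + ‖g₁ x‖ ^ 2 := by
      have h3 : ‖un x‖ ^ 2 ≤ (a * ‖g₀ x‖ + b * ‖g₁ x‖) ^ 2 := by gcongr
      have h4 : (a * ‖g₀ x‖ + b * ‖g₁ x‖) ^ 2 + (b * ‖g₀ x‖ - a * ‖g₁ x‖) ^ 2
          = ‖g₀ x‖ ^ 2 + ‖g₁ x‖ ^ 2 := by
        linear_combination (‖g₀ x‖ ^ 2 + ‖g₁ x‖ ^ 2) * hab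
      linarith [sq_nonneg (b * ‖g₀ x‖ - a * ‖g₁ x‖)]
    have h5 := norm_sub_le (u x) (un x)
    rw [hsq, norm_smul, Real.norm_of_nonneg hpos.le]
    have h6 : κ * (e x * ‖u x - un x‖) ≤ κ * (e x * (‖u x‖ + ‖un x‖)) := by gcongr
    nlinarith [sq_nonneg (κ * e x - (‖u x‖ + ‖un x‖) / 2), sq_nonneg (‖u x‖ - ‖un x‖)]
  have hmono := integral_mono (hint.norm.const_mul κ)
    ((hi2.const_mul (κ ^ 2)).add (hE.div_const 2)) hpt
  simp only [Pi.add_apply] at hmono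
  rw [integral_const_mul, integral_add (hi2.const_mul (κ ^ 2)) (hE.div_const 2),
    integral_const_mul, he2, integral_div] at hmono
  have hn := norm_integral_le_integral_norm (μ := volume.restrict S) fun x => e x • (u x - un x)
  rw [heq, Complex.norm_real, Real.norm_of_nonneg (by positivity)] at hn
  have h7 := (mul_le_mul_of_nonneg_left hn hκ.le).trans hmono
  have h8 : κ * (κ / (2 * a)) = κ ^ 2 / (2 * a) := by ring
  have h9 : κ ^ 2 * (1 / (2 * a * 2)) = κ ^ 2 / (2 * a) / 2 := by ring
  rw [h8, h9] at h7
  linarith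

/-! ### Restriction of weak derivatives and the `H¹` norm -/

theorem IsWeakPartial.mono {d : ℕ} {Ω : Set (EuclideanSpace ℝ (Fin d))} {i : Fin d}
    {f g : EuclideanSpace ℝ (Fin d) → ℂ} (h : IsWeakPartial univ i f g) :
    IsWeakPartial Ω i f g := by
  intro ψ hψ hc hs
  have h0 := h ψ hψ hc (subset_univ _)
  rw [setIntegral_univ, setIntegral_univ] at h0
  have hz : ∀ x ∉ Ω, x ∉ tsupport ψ := fun x hx hm => hx (hs hm)
  rw [setIntegral_eq_integral_of_forall_compl_eq_zero fun x hx => by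
      rw [fderiv_of_notMem_tsupport (𝕜 := ℝ) (hz x hx), zero_apply, zero_smul],
    setIntegral_eq_integral_of_forall_compl_eq_zero fun x hx => by
      rw [image_eq_zero_of_notMem_tsupport (hz x hx), zero_smul]]
  exact h0

theorem IsWeakPartial.congr {d : ℕ} {Ω : Set (EuclideanSpace ℝ (Fin d))} {i : Fin d}
    {f f' g g' : EuclideanSpace ℝ (Fin d) → ℂ} (h : IsWeakPartial Ω i f g)
    (hf : f =ᵐ[volume.restrict Ω] f') (hg : g =ᵐ[volume.restrict Ω] g') :
    IsWeakPartial Ω i f' g' := by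
  intro ψ hψ hc hs
  have e1 : ∫ x in Ω, fderiv ℝ ψ x (EuclideanSpace.single i 1) • f' x =
      ∫ x in Ω, fderiv ℝ ψ x (EuclideanSpace.single i 1) • f x :=
    integral_congr_ae (by filter_upwards [hf] with x hx; rw [hx])
  have e2 : ∫ x in Ω, ψ x • g' x = ∫ x in Ω, ψ x • g x :=
    integral_congr_ae (by filter_upwards [hg] with x hx; rw [hx])
  rw [e1, e2]
  exact h ψ hψ hc hs

theorem isWeakPartial_expFun (κ : ℝ) (i : Fin 2) : IsWeakPartial univ i (expFun κ)
    (fun x => -((EuclideanSpace.single i (1 : ℝ) : EuclideanSpace ℝ (Fin 2)) 1 : ℂ) *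
      expFun κ x) := by
  intro ψ hψ hc _
  rw [setIntegral_univ, setIntegral_univ]
  exact integral_fderiv_smul_expFun κ hψ hc _

/-- If an `H¹` function on the whole space extends `f`, then its weak derivatives extend those
of `f`. -/
theorem weakPartial_ae_eq_of_extends {d : ℕ} {Ω : Set (EuclideanSpace ℝ (Fin d))} (hΩ : IsOpen Ω)
    (f : H1 Ω) (U : H1 (univ : Set (EuclideanSpace ℝ (Fin d))))
    (h : ((U : L2 univ) : EuclideanSpace ℝ (Fin d) → ℂ) =ᵐ[volume.restrict Ω] (f : L2 Ω))
    (i : Fin d) :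
    (weakPartial i U : EuclideanSpace ℝ (Fin d) → ℂ) =ᵐ[volume.restrict Ω] weakPartial i f := by
  have hm : MemLp (weakPartial i U) 2 (volume.restrict Ω) :=
    (Lp.memLp (weakPartial i U)).mono_measure (Measure.restrict_mono (subset_univ _) le_rfl)
  have hw : IsWeakPartial Ω i (f : L2 Ω) (hm.toLp _) :=
    (weakPartial_spec i U).mono.congr h hm.coeFn_toLp.symm
  rw [← hw.unique hΩ (weakPartial_spec i f)]
  exact hm.coeFn_toLp.symm

theorem h1Norm_nonneg {d : ℕ} {Ω : Set (EuclideanSpace ℝ (Fin d))} (f : H1 Ω) : 0 ≤ h1Norm f :=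
  Real.sqrt_nonneg _

theorem h1Norm_sq {d : ℕ} {Ω : Set (EuclideanSpace ℝ (Fin d))} (f : H1 Ω) :
    h1Norm f ^ 2 = (∑ i : Fin d, ‖weakPartial i f‖ ^ 2) + ‖(f : L2 Ω)‖ ^ 2 :=
  Real.sq_sqrt (by positivity)

theorem h1Norm_sq_eq_integral {Ω : Set (EuclideanSpace ℝ (Fin 2))} (f : H1 Ω) :
    h1Norm f ^ 2 = ∫ x in Ω, (‖weakPartial 0 f x‖ ^ 2 + ‖weakPartial 1 f x‖ ^ 2 +
      ‖(f : L2 Ω) x‖ ^ 2) := by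
  have i0 := L2_integrable_norm_sq (weakPartial 0 f)
  have i1 := L2_integrable_norm_sq (weakPartial 1 f)
  rw [h1Norm_sq, Fin.sum_univ_two, L2_norm_sq, L2_norm_sq, L2_norm_sq,
    integral_add (by exact i0.add i1) (L2_integrable_norm_sq (f : L2 Ω)), integral_add i0 i1]

/-! ### Geometry of the wedge and the unit vector -/

theorem sin_half_pos {φ : ℝ} (h0 : 0 < φ) (h1 : φ < Real.pi) : 0 < Real.sin (φ / 2) :=
  Real.sin_pos_of_pos_of_lt_pi (by linarith) (by linarith)

theorem cos_half_pos {φ : ℝ} (h0 : 0 < φ) (h1 : φ < Real.pi) : 0 < Real.cos (φ / 2) :=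
  Real.cos_pos_of_mem_Ioo ⟨by linarith, by linarith⟩

theorem cot_half_pos {φ : ℝ} (h0 : 0 < φ) (h1 : φ < Real.pi) : 0 < Real.cot (φ / 2) := by
  rw [Real.cot_eq_cos_div_sin]
  exact div_pos (cos_half_pos h0 h1) (sin_half_pos h0 h1)

/-- The wedge is the intersection of two half-planes with outward normals `(±cos (φ/2), -sin
(φ/2))`, the normals of the frames for `σ = ±1`. -/
theorem mem_wedge_iff {φ : ℝ} (h0 : 0 < φ) (h1 : φ < Real.pi) (x : EuclideanSpace ℝ (Fin 2)) :
    x ∈ wedge φ ↔ linForm (Real.cos (φ / 2)) (-Real.sin (φ / 2)) x < 0 ∧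
      linForm (-Real.cos (φ / 2)) (-Real.sin (φ / 2)) x < 0 := by
  have hs := sin_half_pos h0 h1
  have hc := cos_half_pos h0 h1
  simp only [wedge, mem_ofPred_eq, linForm_apply, gt_iff_lt, Real.cot_eq_cos_div_sin]
  rw [div_mul_eq_mul_div, div_lt_iff₀ hs, ← abs_of_pos hc, ← abs_mul, abs_of_pos hc, abs_lt]
  constructor
  · rintro ⟨h2, h3⟩
    exact ⟨by linarith, by linarith⟩
  · rintro ⟨h2, h3⟩
    exact ⟨by linarith, by linarith⟩

theorem isOpen_wedge (φ : ℝ) : IsOpen (wedge φ) :=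
  isOpen_lt (by fun_prop) (by fun_prop)

/-- The function `κ exp (-x₁)`, suitably normalised, is a unit vector of `H¹` of the wedge. -/
theorem exists_unit_exp {φ : ℝ} (h0 : 0 < φ) (h1 : φ < Real.pi) :
    ∃ f : H1 (wedge φ), h1Norm f = 1 ∧
      ((f : L2 (wedge φ)) : EuclideanSpace ℝ (Fin 2) → ℂ) =ᵐ[volume.restrict (wedge φ)]
        expFun (Real.sqrt (Real.cot (φ / 2))) ∧
      weakPartial 0 f = 0 ∧ weakPartial 1 f = -(f : L2 (wedge φ)) := by
  have hc := cot_half_pos h0 h1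
  set κ := Real.sqrt (Real.cot (φ / 2)) with hκ
  have hκ2 : κ ^ 2 = Real.cot (φ / 2) := Real.sq_sqrt hc.le
  obtain ⟨hi, hv⟩ := integral_exp_cone hc
  have hsq : ∀ x, ‖expFun κ x‖ ^ 2 = Real.cot (φ / 2) * Real.exp (-2 * x 1) := by
    intro x
    rw [norm_expFun, mul_pow, sq_abs, hκ2, ← Real.exp_nat_mul]
    ring_nf
  have hm : MemLp (expFun κ) 2 (volume.restrict (wedge φ)) := by
    rw [memLp_two_iff_integrable_sq_norm (continuous_expFun κ).aestronglyMeasurable]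
    simp only [hsq]
    exact hi.const_mul _
  have hF := hm.coeFn_toLp
  set F : L2 (wedge φ) := hm.toLp _
  have hw0 : IsWeakPartial (wedge φ) 0 F (0 : L2 (wedge φ)) := by
    refine (isWeakPartial_expFun κ 0).mono.congr hF.symm ?_
    filter_upwards [Lp.coeFn_zero ℂ 2 (volume.restrict (wedge φ))] with x hx
    rw [hx]
    simp
  have hw1 : IsWeakPartial (wedge φ) 1 F (-F : L2 (wedge φ)) := by
    refine (isWeakPartial_expFun κ 1).mono.congr hF.symm ?_
    filter_upwards [Lp.coeFn_neg F, hF] with x hx hx'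
    rw [hx, Pi.neg_apply, hx']
    simp
  have hFm : F ∈ H1 (wedge φ) := by
    intro i
    fin_cases i
    · exact ⟨_, hw0⟩
    · exact ⟨_, hw1⟩
  have hp0 : weakPartial 0 (⟨F, hFm⟩ : H1 (wedge φ)) = 0 :=
    (weakPartial_spec 0 (⟨F, hFm⟩ : H1 (wedge φ))).unique (isOpen_wedge φ) hw0
  have hp1 : weakPartial 1 (⟨F, hFm⟩ : H1 (wedge φ)) = -F :=
    (weakPartial_spec 1 (⟨F, hFm⟩ : H1 (wedge φ))).unique (isOpen_wedge φ) hw1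
  refine ⟨⟨F, hFm⟩, ?_, hF, hp0, hp1⟩
  have hFn : ‖F‖ ^ 2 = 1 / 2 := by
    rw [L2_norm_sq, integral_congr_ae (g := fun x => Real.cot (φ / 2) * Real.exp (-2 * x 1))
      (by filter_upwards [hF] with x hx; rw [hx, hsq]), integral_const_mul]
    refine (congrArg (Real.cot (φ / 2) * ·) hv).trans ?_
    field_simp
  refine (sq_eq_sq₀ (h1Norm_nonneg _) zero_le_one).1 ?_
  rw [h1Norm_sq, Fin.sum_univ_two, hp0, hp1, norm_neg, norm_zero, hFn]
  norm_num

/-- At a common point, adding the two tangential inequalities gives `x₁ > 0` and adding the two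
normal ones gives `x₁ < 0`. -/
theorem disjoint_quadrants {a b : ℝ} (ha : 0 < a) (hb : 0 < b) :
    Disjoint (quadrant 1 a b) (quadrant (-1) a b) := by
  refine Set.disjoint_left.2 fun x hx hy => ?_
  obtain ⟨h1, h2⟩ := hx
  obtain ⟨h3, h4⟩ := hy
  simp only [linForm_apply] at h1 h2 h3 h4
  have h5 : 0 < a * x 1 := by linarith
  have h6 : b * x 1 < 0 := by linarith
  have h7 : 0 < x 1 := by
    by_contra h
    nlinarith
  nlinarith

/-! ### Assembling the bound -/

/-- The energy of any `H¹` extension of the exponential from the wedge. -/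
theorem one_add_inv_sin_le_h1Norm_sq {φ : ℝ} (h0 : 0 < φ) (h1 : φ < Real.pi) {f : H1 (wedge φ)}
    (hf1 : h1Norm f = 1)
    (hf : ((f : L2 (wedge φ)) : EuclideanSpace ℝ (Fin 2) → ℂ) =ᵐ[volume.restrict (wedge φ)]
      expFun (Real.sqrt (Real.cot (φ / 2))))
    (hp0 : weakPartial 0 f = 0) (hp1 : weakPartial 1 f = -(f : L2 (wedge φ)))
    (U : H1 (univ : Set (EuclideanSpace ℝ (Fin 2))))
    (hU : ((U : L2 univ) : EuclideanSpace ℝ (Fin 2) → ℂ) =ᵐ[volume.restrict (wedge φ)]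
      (f : L2 (wedge φ))) :
    1 + 1 / Real.sin (φ / 2) ≤ h1Norm U ^ 2 := by
  have hs := sin_half_pos h0 h1
  have hc := cos_half_pos h0 h1
  have hcot := cot_half_pos h0 h1
  have hab : Real.cos (φ / 2) ^ 2 + Real.sin (φ / 2) ^ 2 = 1 := Real.cos_sq_add_sin_sq _
  have hw := mem_wedge_iff h0 h1
  have hκ := Real.sqrt_pos.2 hcot
  have hκ2 : Real.sqrt (Real.cot (φ / 2)) ^ 2 = Real.cos (φ / 2) / Real.sin (φ / 2) := by
    rw [Real.sq_sqrt hcot.le, Real.cot_eq_cos_div_sin]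
  set κ := Real.sqrt (Real.cot (φ / 2))
  set a := Real.cos (φ / 2)
  set b := Real.sin (φ / 2)
  have hU0 := weakPartial_ae_eq_of_extends (isOpen_wedge φ) f U hU 0
  have hU1 := weakPartial_ae_eq_of_extends (isOpen_wedge φ) f U hU 1
  have hW : ∫ x in wedge φ, (‖weakPartial 0 U x‖ ^ 2 + ‖weakPartial 1 U x‖ ^ 2 +
      ‖(U : L2 univ) x‖ ^ 2) = 1 := by
    have hf2 : h1Norm f ^ 2 = 1 := by rw [hf1, one_pow]
    rw [h1Norm_sq_eq_integral] at hf2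
    refine (integral_congr_ae ?_).trans hf2
    filter_upwards [hU0, hU1, hU] with x h2 h3 h4
    rw [h2, h3, h4]
  have huc : ∀ᵐ x : EuclideanSpace ℝ (Fin 2), x ∈ wedge φ → (U : L2 univ) x = expFun κ x ∧
      weakPartial 0 U x = 0 ∧ weakPartial 1 U x = -expFun κ x := by
    rw [← ae_restrict_iff' (isOpen_wedge φ).measurableSet]
    rw [hp0] at hU0
    rw [hp1] at hU1
    filter_upwards [hU0, hU1, hU, hf, Lp.coeFn_zero ℂ 2 (volume.restrict (wedge φ)),
      Lp.coeFn_neg (f : L2 (wedge φ))] with x q0 q1 q2 q3 q4 q5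
    refine ⟨q2.trans q3, q0.trans q4, ?_⟩
    rw [q1, q5, Pi.neg_apply, q3]
  have hmem : ∀ g : L2 (univ : Set (EuclideanSpace ℝ (Fin 2))), MemLp g 2 volume := by
    intro g
    have : ∀ u : EuclideanSpace ℝ (Fin 2) → ℂ, MemLp u 2 (volume.restrict univ) →
        MemLp u 2 volume := fun u hu => by rwa [Measure.restrict_univ] at hu
    exact this _ (Lp.memLp g)
  have hq : ∀ σ : ℝ, σ = 1 ∨ σ = -1 → κ ^ 2 / (2 * a) ≤ ∫ x in quadrant σ a b,
      (‖weakPartial 0 U x‖ ^ 2 + ‖weakPartial 1 U x‖ ^ 2 + ‖(U : L2 univ) x‖ ^ 2) := by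
    intro σ hσ
    refine energy_quadrant_ge (by rcases hσ with rfl | rfl <;> norm_num) hab hc hs hκ (hmem _)
      (hmem _) (hmem _) (weakPartial_spec 0 U) (weakPartial_spec 1 U) ?_
    filter_upwards [huc] with x hx h2 h3
    refine hx ((hw x).2 ?_)
    -- The two half-plane conditions trade places under `σ ↦ -σ`.
    rcases hσ with rfl | rfl
    · rw [one_mul] at h2 h3
      exact ⟨h2, h3⟩
    · rw [neg_one_mul] at h2 h3
      rw [neg_neg] at h3
      exact ⟨h3, h2⟩
  have hE : Integrable fun x => ‖weakPartial 0 U x‖ ^ 2 + ‖weakPartial 1 U x‖ ^ 2 +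
      ‖(U : L2 univ) x‖ ^ 2 :=
    (((hmem _).integrable_norm_pow (by norm_num)).add
      ((hmem _).integrable_norm_pow (by norm_num))).add
      ((hmem _).integrable_norm_pow (by norm_num))
  have hd : Disjoint (wedge φ) (quadrant 1 a b ∪ quadrant (-1) a b) := by
    refine Set.disjoint_left.2 fun x hx hy => ?_
    obtain ⟨h2, h3⟩ := (hw x).1 hx
    rcases hy with hy | hy
    · have := hy.2
      rw [one_mul] at this
      exact lt_asymm this h2
    · have := hy.2
      rw [neg_one_mul] at this
      exact lt_asymm this h3
  have hmq := fun σ => (isOpen_quadrant σ a b).measurableSet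
  -- The energy outside the wedge and the two quadrants is nonnegative and is dropped.
  have hsplit := setIntegral_le_integral
    (s := wedge φ ∪ (quadrant 1 a b ∪ quadrant (-1) a b)) hE (ae_of_all _ fun x => by
      simp only [Pi.zero_apply]
      positivity)
  rw [setIntegral_union hd ((hmq _).union (hmq _)) hE.integrableOn hE.integrableOn,
    setIntegral_union (disjoint_quadrants hc hs) (hmq _) hE.integrableOn hE.integrableOn,
    hW] at hsplit
  rw [h1Norm_sq_eq_integral, setIntegral_univ]
  have h2 := hq 1 (Or.inl rfl)
  have h3 := hq (-1) (Or.inr rfl)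
  -- With `κ² = a / b` each quadrant contributes `1 / (2b)`, so together they give `1 / sin (φ/2)`.
  have h4 : κ ^ 2 / (2 * a) = 1 / b / 2 := by
    rw [hκ2]
    field_simp
  linarith

theorem ofReal_sqrt_le_extConst_wedge {φ : ℝ} (h0 : 0 < φ) (h1 : φ < Real.pi) :
    ENNReal.ofReal (Real.sqrt (1 + 1 / Real.sin (φ / 2))) ≤ extConst (wedge φ) := by
  obtain ⟨f, hf1, hf, hp0, hp1⟩ := exists_unit_exp h0 h1
  refine le_iInf₂ fun E hE => ?_
  refine le_trans (ENNReal.ofReal_le_ofReal ?_) (le_iSup₂ (f := fun (g : H1 (wedge φ))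
    (_ : h1Norm g = 1) => ENNReal.ofReal (h1Norm (E g))) f hf1)
  exact Real.sqrt_le_left (h1Norm_nonneg _) |>.2
    (one_add_inv_sin_le_h1Norm_sq h0 h1 hf1 hf hp0 hp1 (E f) (hE.1 f))

theorem tendsto_ofReal_sqrt_one_add_inv_sin :
    Tendsto (fun φ : ℝ => ENNReal.ofReal (Real.sqrt (1 + 1 / Real.sin (φ / 2))))
      (𝓝[>] 0) (𝓝 ⊤) := by
  have hs : Tendsto (fun φ : ℝ => Real.sin (φ / 2)) (𝓝[>] 0) (𝓝[>] 0) := by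
    refine tendsto_nhdsWithin_iff.2 ⟨?_, ?_⟩
    · have : Continuous fun φ : ℝ => Real.sin (φ / 2) := by fun_prop
      simpa using (this.tendsto 0).mono_left nhdsWithin_le_nhds
    · filter_upwards [Ioo_mem_nhdsGT Real.pi_pos] with φ hφ using sin_half_pos hφ.1 hφ.2
  refine ENNReal.tendsto_ofReal_atTop.comp (Real.tendsto_sqrt_atTop.comp
    (tendsto_atTop_add_const_left _ 1 ?_))
  simpa only [one_div] using! tendsto_inv_nhdsGT_zero.comp hs

end

theorem mainTheorem3 :
    (∀ φ : ℝ, 0 < φ → φ < Real.pi →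
      ENNReal.ofReal (Real.sqrt (1 + 1 / Real.sin (φ / 2))) ≤ extConst (wedge φ)) ∧
    Tendsto (fun φ : ℝ => extConst (wedge φ)) (𝓝[>] 0) (𝓝 ⊤) := by
  refine ⟨fun φ h0 h1 => ofReal_sqrt_le_extConst_wedge h0 h1, ?_⟩
  refine tendsto_nhds_top_mono tendsto_ofReal_sqrt_one_add_inv_sin ?_
  filter_upwards [Ioo_mem_nhdsGT Real.pi_pos] with φ hφ
  exact ofReal_sqrt_le_extConst_wedge hφ.1 hφ.2
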